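/- Let $p>q\ge 1$ be coprime integers and let $k$ be a commutative ring. Let $\mathcal C_{p,q}$ be the semifree dg algebra over $k$ freely generated as an associative unital algebra by $x,y,z$ of degrees $|x|=0$, $|y|=-1$, $|z|=-2$, with differential of degree $+1$ determined by the graded Leibniz rule $d(ab)=(da)b+(-1)^{|a|}a(db)$ and $$dx=0,\qquad dy=1-x^p,\qquad dz=x^qy-yx^q .$$ Let $\mathcal E=k\langle\alpha,\gamma\rangle/(\alpha^p=1,\ \alpha\gamma=\gamma\alpha)$ with $|\alpha|=0$, $|\gamma|=-2$ and zero differential, and let $\pi\colon\mathcal C_{p,q}\to\mathcal E$ be the dg algebra morphism with $\pi(x)=\alpha$, $\pi(y)=0$, $\pi(z)=\gamma$. 1. If $k=\mathbb Z$, then $\pi$ is quasi-faithful, i.e. $H^n(\pi)\colon H^n(\mathcal C_{p,q})\to H^n(\mathcal E)$ is injective for every $n\in\mathbb Z$. 2. If $k$ is a field whose characteristic does not divide $p$ (that is, $p\ne 0$ in $k$), then $\pi$ is a quasi-equivalence of dg algebras, regarded as dg categories with one object (it induces isomorphisms on cohomology and its $H^0$-functor is essentially surjective). 3. Consequently, if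 $k$ is a field whose characteristic does not divide $p$, then for all integers $q_1,q_2$ with $1\le q_i<p$ and $\gcd(p,q_i)=1$ the dg algebras $\mathcal C_{p,q_1}$ and $\mathcal C_{p,q_2}$ are quasi-equivalent, i.e. isomorphic in the localisation of the category of small dg categories over $k$ at the quasi-equivalences. -/

import Mathlib

open CategoryTheory

universe u

/-! ## Differential graded categories -/

/-- A small `k`-linear dg category.  Gradings are internal: `Hom A B` is the total module of
morphisms and `deg A B n` is its submodule of morphisms of degree `n`.  `comp g f` is the
composite `g ∘ f`. -/
structure DGCat (k : Type u) [CommRing k] where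
  Obj : Type u
  Hom : Obj → Obj → Type u
  [addCommGroup : ∀ A B, AddCommGroup (Hom A B)]
  [module : ∀ A B, Module k (Hom A B)]
  deg : ∀ A B, ℤ → Submodule k (Hom A B)
  isInternal : ∀ A B, DirectSum.IsInternal (deg A B)
  d : ∀ A B, Hom A B →ₗ[k] Hom A B
  d_mem : ∀ {A B n} {f : Hom A B}, f ∈ deg A B n → d A B f ∈ deg A B (n + 1)
  d_d : ∀ {A B} (f : Hom A B), d A B (d A B f) = 0
  comp : ∀ {A B C}, Hom B C →ₗ[k] Hom A B →ₗ[k] Hom A C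
  comp_mem : ∀ {A B C m n} {g : Hom B C} {f : Hom A B},
    g ∈ deg B C m → f ∈ deg A B n → comp g f ∈ deg A C (m + n)
  assoc : ∀ {A B C D} (h : Hom C D) (g : Hom B C) (f : Hom A B),
    comp (comp h g) f = comp h (comp g f)
  leibniz : ∀ {A B C n} {g : Hom B C} (f : Hom A B), g ∈ deg B C n →
    d A C (comp g f) = comp (d B C g) f + n.negOnePow • comp g (d A B f)
  one : ∀ A, Hom A A
  one_comp : ∀ {A B} (f : Hom A B), comp (one B) f = f
  comp_one : ∀ {A B} (f : Hom A B), comp f (one A) = f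
  one_mem : ∀ A, one A ∈ deg A A 0
  d_one : ∀ A, d A A (one A) = 0

namespace DGCat

attribute [instance] DGCat.addCommGroup DGCat.module

variable {k : Type u} [CommRing k]

/-- Closed morphisms of degree `n`. -/
def cocycles (C : DGCat k) (A B : C.Obj) (n : ℤ) : Submodule k (C.Hom A B) :=
  LinearMap.ker (C.d A B) ⊓ C.deg A B n

/-- Exact morphisms of degree `n`. -/
def coboundaries (C : DGCat k) (A B : C.Obj) (n : ℤ) : Submodule k (C.Hom A B) :=
  (C.deg A B (n - 1)).map (C.d A B)

/-- The cohomology `Hⁿ` of the morphism complex from `A` to `B`. -/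
abbrev cohomology (C : DGCat k) (A B : C.Obj) (n : ℤ) : Type u :=
  C.cocycles A B n ⧸ (C.coboundaries A B n).submoduleOf (C.cocycles A B n)

/-- Two objects are isomorphic in the homotopy category `H⁰ C`: there are closed morphisms of
degree zero in both directions whose composites are cohomologous to the identities. -/
def HomotopyIso (C : DGCat k) (A B : C.Obj) : Prop :=
  ∃ f ∈ C.cocycles A B 0, ∃ g ∈ C.cocycles B A 0,
    C.comp g f - C.one A ∈ C.coboundaries A A 0 ∧ C.comp f g - C.one B ∈ C.coboundaries B B 0

end DGCat

/-- A dg functor. -/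
@[ext]
structure DGFunctor {k : Type u} [CommRing k] (C D : DGCat k) where
  obj : C.Obj → D.Obj
  map : ∀ A B, C.Hom A B →ₗ[k] D.Hom (obj A) (obj B)
  map_mem : ∀ {A B n} {f : C.Hom A B}, f ∈ C.deg A B n → map A B f ∈ D.deg (obj A) (obj B) n
  map_d : ∀ {A B} (f : C.Hom A B), map A B (C.d A B f) = D.d (obj A) (obj B) (map A B f)
  map_one : ∀ A, map A A (C.one A) = D.one (obj A)
  map_comp : ∀ {A B E} (g : C.Hom B E) (f : C.Hom A B),
    map A E (C.comp g f) = D.comp (map B E g) (map A B f)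

namespace DGFunctor

variable {k : Type u} [CommRing k] {C D E : DGCat k}

/-- The identity dg functor. -/
def id (C : DGCat k) : DGFunctor C C where
  obj A := A
  map _ _ := LinearMap.id
  map_mem h := h
  map_d _ := rfl
  map_one _ := rfl
  map_comp _ _ := rfl

/-- Composition of dg functors, first `F` and then `G`. -/
def comp (F : DGFunctor C D) (G : DGFunctor D E) : DGFunctor C E where
  obj A := G.obj (F.obj A)
  map A B := G.map (F.obj A) (F.obj B) ∘ₗ F.map A B
  map_mem h := G.map_mem (F.map_mem h)
  map_d f := by simp [F.map_d, G.map_d]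
  map_one A := by simp [F.map_one, G.map_one]
  map_comp g f := by simp [F.map_comp, G.map_comp]

theorem map_mem_cocycles (F : DGFunctor C D) {A B : C.Obj} {n : ℤ} {f : C.Hom A B}
    (hf : f ∈ C.cocycles A B n) : F.map A B f ∈ D.cocycles (F.obj A) (F.obj B) n := by
  refine ⟨?_, F.map_mem hf.2⟩
  have h : C.d A B f = 0 := hf.1
  simp [← F.map_d, h]

theorem map_mem_coboundaries (F : DGFunctor C D) {A B : C.Obj} {n : ℤ} {f : C.Hom A B}
    (hf : f ∈ C.coboundaries A B n) : F.map A B f ∈ D.coboundaries (F.obj A) (F.obj B) n := by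
  obtain ⟨e, he, rfl⟩ := hf
  exact ⟨F.map A B e, F.map_mem he, (F.map_d e).symm⟩

/-- The map induced by a dg functor on the cohomology of morphism complexes. -/
def cohomologyMap (F : DGFunctor C D) (A B : C.Obj) (n : ℤ) :
    C.cohomology A B n →ₗ[k] D.cohomology (F.obj A) (F.obj B) n :=
  Submodule.mapQ _ _ ((F.map A B).restrict fun _ hf => F.map_mem_cocycles hf)
    fun _ hf => F.map_mem_coboundaries hf

/-- `F` is injective on the cohomology of all morphism complexes. -/
def QuasiFaithful (F : DGFunctor C D) : Prop :=
  ∀ A B n, Function.Injective (F.cohomologyMap A B n)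

/-- `F` is a quasi-isomorphism on all morphism complexes. -/
def QuasiFullyFaithful (F : DGFunctor C D) : Prop :=
  ∀ A B n, Function.Bijective (F.cohomologyMap A B n)

/-- `H⁰ F` is essentially surjective. -/
def QuasiEssSurj (F : DGFunctor C D) : Prop :=
  ∀ Y : D.Obj, ∃ X : C.Obj, D.HomotopyIso (F.obj X) Y

/-- Quasi-equivalences of dg categories. -/
def IsQuasiEquivalence (F : DGFunctor C D) : Prop :=
  F.QuasiFullyFaithful ∧ F.QuasiEssSurj

end DGFunctor

namespace DGCat

variable {k : Type u} [CommRing k]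

/-- The category of small dg categories over `k`. -/
instance : Category (DGCat k) where
  Hom C D := DGFunctor C D
  id C := DGFunctor.id C
  comp F G := DGFunctor.comp F G

/-- The class of quasi-equivalences in the category of dg categories. -/
def quasiEquivalences (k : Type u) [CommRing k] : MorphismProperty (DGCat k) :=
  fun _ _ F => DGFunctor.IsQuasiEquivalence F

/-- Two dg categories are quasi-equivalent if they become isomorphic in the localisation of the
category of dg categories at the quasi-equivalences. -/
def QuasiEquivalent (C D : DGCat k) : Prop :=
  Nonempty ((quasiEquivalences k).Q.obj C ≅ (quasiEquivalences k).Q.obj D)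

end DGCat

/-! ## Differential graded algebras -/

/-- The data making a `k`-algebra `A` into a dg algebra: a `ℤ`-grading and a differential of
degree `1` satisfying the graded Leibniz rule. -/
structure DGAlgStruct (k A : Type u) [CommRing k] [Ring A] [Algebra k A] where
  deg : ℤ → Submodule k A
  isInternal : DirectSum.IsInternal deg
  one_mem : (1 : A) ∈ deg 0
  mul_mem : ∀ {m n} {a b : A}, a ∈ deg m → b ∈ deg n → a * b ∈ deg (m + n)
  d : A →ₗ[k] A
  d_mem : ∀ {n} {a : A}, a ∈ deg n → d a ∈ deg (n + 1)
  d_d : ∀ a, d (d a) = 0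
  leibniz : ∀ {n} {a : A} (b : A), a ∈ deg n → d (a * b) = d a * b + n.negOnePow • (a * d b)

namespace DGAlgStruct

variable {k A B : Type u} [CommRing k] [Ring A] [Algebra k A] [Ring B] [Algebra k B]

theorem d_one (S : DGAlgStruct k A) : S.d 1 = 0 := by
  have h := S.leibniz (1 : A) S.one_mem
  simpa using h

/-- A dg algebra regarded as a dg category with one object. -/
def toDGCat (S : DGAlgStruct k A) : DGCat k where
  Obj := PUnit
  Hom _ _ := A
  addCommGroup _ _ := inferInstance
  module _ _ := inferInstance
  deg _ _ := S.deg
  isInternal _ _ := S.isInternal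
  d _ _ := S.d
  d_mem h := S.d_mem h
  d_d a := S.d_d a
  comp := LinearMap.mul k A
  comp_mem hg hf := S.mul_mem hg hf
  assoc h g f := mul_assoc h g f
  leibniz f hg := S.leibniz f hg
  one _ := 1
  one_comp f := one_mul f
  comp_one f := mul_one f
  one_mem _ := S.one_mem
  d_one _ := S.d_one

/-- A dga morphism, i.e. an algebra map preserving degrees and commuting with the differentials,
regarded as a dg functor between dg categories with one object. -/
def functorOfAlgHom (S : DGAlgStruct k A) (T : DGAlgStruct k B) (φ : A →ₐ[k] B)
    (hdeg : ∀ n a, a ∈ S.deg n → φ a ∈ T.deg n) (hd : ∀ a, φ (S.d a) = T.d (φ a)) :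
    DGFunctor S.toDGCat T.toDGCat where
  obj A := A
  map _ _ := φ.toLinearMap
  map_mem h := hdeg _ _ h
  map_d a := hd a
  map_one _ := map_one φ
  map_comp g f := map_mul φ (show A from g) (show A from f)

end DGAlgStruct

/-! ## The grading of an algebra generated by homogeneous generators -/

section WordGrading

variable {k A ι : Type*} [CommRing k] [Ring A] [Algebra k A]

/-- The span of the products of generators `g i` of total weight `n`, where `g i` has
weight `w i`. -/
def wordDeg (k : Type*) {A ι : Type*} [CommRing k] [Ring A] [Algebra k A]
    (g : ι → A) (w : ι → ℤ) (n : ℤ) : Submodule k A :=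
  Submodule.span k {a | ∃ l : List ι, (l.map w).sum = n ∧ (l.map g).prod = a}

theorem wordDeg_gen (g : ι → A) (w : ι → ℤ) (i : ι) : g i ∈ wordDeg k g w (w i) :=
  Submodule.subset_span ⟨[i], by simp, by simp⟩

instance wordDeg_gradedMonoid (g : ι → A) (w : ι → ℤ) :
    SetLike.GradedMonoid (wordDeg k g w) where
  one_mem := Submodule.subset_span ⟨[], by simp, by simp⟩
  mul_mem := by
    intro m n a b ha hb
    have h := Submodule.mul_mem_mul ha hb
    rw [wordDeg, wordDeg, Submodule.span_mul_span] at h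
    refine Submodule.span_mono ?_ h
    rintro _ ⟨_, ⟨l, hl, rfl⟩, _, ⟨l', hl', rfl⟩, rfl⟩
    exact ⟨l ++ l', by simp [hl, hl'], by simp⟩

/-- If the generators determine algebra maps out of `A`, and the generators, placed in their
degrees, lift to a map from `A` to the direct sum of the graded pieces, then `A` is the internal
direct sum of these pieces. -/
theorem wordDeg_isInternal (g : ι → A) (w : ι → ℤ)
    (hext : ∀ f : A →ₐ[k] A, (∀ i, f (g i) = g i) → f = AlgHom.id k A)
    (φ : A →ₐ[k] DirectSum ℤ fun n => wordDeg k g w n)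
    (hφ : ∀ i, φ (g i) = DirectSum.of (fun n => wordDeg k g w n) (w i)
      ⟨g i, wordDeg_gen g w i⟩) :
    DirectSum.IsInternal (wordDeg k g w) := by
  classical
  have hlist : ∀ l : List ι, ∀ h : (l.map g).prod ∈ wordDeg k g w (l.map w).sum,
      φ (l.map g).prod = DirectSum.of (fun n => wordDeg k g w n) (l.map w).sum ⟨_, h⟩ := by
    intro l
    induction l with
    | nil => intro h; simp only [List.map_nil, List.prod_nil, map_one]; rfl
    | cons i l ih =>
      intro h
      have hl : (l.map g).prod ∈ wordDeg k g w (l.map w).sum :=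
        Submodule.subset_span ⟨l, rfl, rfl⟩
      simp only [List.map_cons, List.prod_cons, map_mul, hφ, ih hl]
      rw [DirectSum.of_mul_of]
      rfl
  have hleft : ∀ n (x : wordDeg k g w n), φ x = DirectSum.of (fun n => wordDeg k g w n) n x := by
    rintro n ⟨x, hx⟩
    change φ.toLinearMap x = DirectSum.lof k ℤ (fun n => wordDeg k g w n) n ⟨x, hx⟩
    induction hx using Submodule.span_induction with
    | mem x h =>
      obtain ⟨l, rfl, rfl⟩ := h
      exact hlist l _
    | zero => simp only [map_zero]; exact (map_zero (DirectSum.lof k ℤ _ n)).symm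
    | add x y hx hy h1 h2 => rw [map_add, h1, h2, ← map_add]; rfl
    | smul c x hx h1 => rw [map_smul, h1, ← map_smul]; rfl
  have := GradedAlgebra.ofAlgHom (wordDeg k g w) φ
    (hext _ fun i => by simp [hφ]) hleft
  exact DirectSum.Decomposition.isInternal _

end WordGrading

/-! ## Semifree dg algebras -/

namespace Semifree

variable {k : Type u} [CommRing k] {ι : Type} (w : ι → ℤ) (δ : ι → FreeAlgebra k ι)

/-- The grading of the free algebra in which the generator `i` has degree `w i`. -/
abbrev deg (k : Type u) [CommRing k] {ι : Type} (w : ι → ℤ) : ℤ → Submodule k (FreeAlgebra k ι) :=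
  wordDeg k (FreeAlgebra.ι k) w

theorem isInternal : DirectSum.IsInternal (deg k w) :=
  wordDeg_isInternal _ w
    (fun f hf => FreeAlgebra.hom_ext (funext fun i => by simpa using hf i))
    (FreeAlgebra.lift k fun i => DirectSum.of (fun n => deg k w n) (w i)
      ⟨FreeAlgebra.ι k i, wordDeg_gen _ w i⟩)
    (fun i => by simp)

/-- The algebra map `a ↦ !![(-1)^|a| a, d a; 0, a]`; its multiplicativity is the graded Leibniz
rule for `d`. -/
noncomputable def leibnizHom : FreeAlgebra k ι →ₐ[k] Matrix (Fin 2) (Fin 2) (FreeAlgebra k ι) :=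
  FreeAlgebra.lift k fun i =>
    !![(w i).negOnePow • FreeAlgebra.ι k i, δ i; 0, FreeAlgebra.ι k i]

/-- The unique graded derivation of the free algebra sending the generator `i` to `δ i`. -/
noncomputable def d : FreeAlgebra k ι →ₗ[k] FreeAlgebra k ι where
  toFun a := leibnizHom w δ a 0 1
  map_add' a b := by simp
  map_smul' c a := by simp

@[simp]
theorem d_ι (i : ι) : d w δ (FreeAlgebra.ι k i) = δ i := by
  simp [d, leibnizHom]

theorem leibnizHom_entries (a : FreeAlgebra k ι) :
    leibnizHom w δ a 1 0 = 0 ∧ leibnizHom w δ a 1 1 = a := by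
  induction a using FreeAlgebra.induction with
  | grade0 r => simp [Matrix.algebraMap_matrix_apply]
  | grade1 i => simp [leibnizHom]
  | mul a b ha hb => simp [Matrix.mul_apply, Fin.sum_univ_two, ha, hb]
  | add a b ha hb => simp [ha, hb]

theorem leibnizHom_sign {n : ℤ} {a : FreeAlgebra k ι} (ha : a ∈ deg k w n) :
    leibnizHom w δ a 0 0 = n.negOnePow • a := by
  induction ha using Submodule.span_induction with
  | mem x h =>
    obtain ⟨l, rfl, rfl⟩ := h
    induction l with
    | nil => simp
    | cons i l ih =>
      simp only [List.map_cons, List.prod_cons, map_mul, Matrix.mul_apply, Fin.sum_univ_two, ih,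
        (leibnizHom_entries w δ _).1, mul_zero, add_zero, List.sum_cons, Int.negOnePow_add]
      simp [leibnizHom, smul_mul_smul_comm]
  | zero => simp
  | add x y _ _ hx hy => simp [hx, hy]
  | smul c x _ hx =>
    rw [map_smul, Matrix.smul_apply, hx, Units.smul_def, Units.smul_def, smul_comm]

theorem leibniz {n : ℤ} {a : FreeAlgebra k ι} (b : FreeAlgebra k ι) (ha : a ∈ deg k w n) :
    d w δ (a * b) = d w δ a * b + n.negOnePow • (a * d w δ b) := by
  change leibnizHom w δ (a * b) 0 1 = leibnizHom w δ a 0 1 * b + _ • (a * leibnizHom w δ b 0 1)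
  rw [map_mul, Matrix.mul_apply, Fin.sum_univ_two, leibnizHom_sign w δ ha,
    (leibnizHom_entries w δ b).2, add_comm, smul_mul_assoc]

theorem d_one : d w δ 1 = 0 := by
  simp [d]

theorem word_mem (l : List ι) :
    (l.map (FreeAlgebra.ι k)).prod ∈ deg k w (l.map w).sum :=
  Submodule.subset_span ⟨l, rfl, rfl⟩

theorem d_mem (hδ : ∀ i, δ i ∈ deg k w (w i + 1)) {n : ℤ} {a : FreeAlgebra k ι}
    (ha : a ∈ deg k w n) : d w δ a ∈ deg k w (n + 1) := by
  induction ha using Submodule.span_induction with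
  | mem x h =>
    obtain ⟨l, rfl, rfl⟩ := h
    induction l with
    | nil => simp [d_one]
    | cons i l ih =>
      simp only [List.map_cons, List.prod_cons, List.sum_cons]
      rw [leibniz w δ _ (wordDeg_gen _ w i), d_ι]
      refine add_mem ?_ ?_
      · have := SetLike.mul_mem_graded (hδ i) (word_mem (k := k) w l)
        rwa [add_right_comm] at this
      · have := SetLike.mul_mem_graded (wordDeg_gen (k := k) (FreeAlgebra.ι k) w i) ih
        rw [← add_assoc] at this
        rw [Units.smul_def]
        exact zsmul_mem this _
  | zero => simp
  | add x y _ _ hx hy => rw [map_add]; exact add_mem hx hy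
  | smul c x _ hx => rw [map_smul]; exact Submodule.smul_mem _ _ hx

theorem d_d (hδ : ∀ i, δ i ∈ deg k w (w i + 1)) (hδδ : ∀ i, d w δ (δ i) = 0)
    (a : FreeAlgebra k ι) : d w δ (d w δ a) = 0 := by
  have hmul : ∀ i, ∀ b : FreeAlgebra k ι, d w δ (d w δ b) = 0 →
      d w δ (d w δ (FreeAlgebra.ι k i * b)) = 0 := by
    intro i b hb
    rw [leibniz w δ _ (wordDeg_gen _ w i), d_ι, map_add, leibniz w δ _ (hδ i), hδδ]
    have : d w δ ((w i).negOnePow • (FreeAlgebra.ι k i * d w δ b)) =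
        (w i).negOnePow • d w δ (FreeAlgebra.ι k i * d w δ b) := by
      rw [Units.smul_def, map_zsmul, ← Units.smul_def]
    rw [this, leibniz w δ _ (wordDeg_gen _ w i), d_ι, hb, Int.negOnePow_succ]
    simp
  have hleft : ∀ a b : FreeAlgebra k ι, d w δ (d w δ b) = 0 → d w δ (d w δ (a * b)) = 0 := by
    intro a
    induction a using FreeAlgebra.induction with
    | grade0 r => intro b hb; rw [← Algebra.smul_def, map_smul, map_smul, hb, smul_zero]
    | grade1 i => exact hmul i
    | mul a a' ha ha' => intro b hb; rw [mul_assoc]; exact ha _ (ha' b hb)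
    | add a a' ha ha' => intro b hb; rw [add_mul, map_add, map_add, ha b hb, ha' b hb, add_zero]
  simpa using hleft a 1 (by simp [d_one])

/-- The semifree dg algebra with generators `i` of degree `w i` and differentials `δ i`. -/
noncomputable def dga {k : Type u} {ι : Type} [CommRing k] (w : ι → ℤ)
    (δ : ι → FreeAlgebra k ι) (hδ : ∀ i, δ i ∈ deg k w (w i + 1))
    (hδδ : ∀ i, d w δ (δ i) = 0) : DGAlgStruct k (FreeAlgebra k ι) where
  deg := deg k w
  isInternal := isInternal w
  one_mem := SetLike.one_mem_graded _
  mul_mem ha hb := SetLike.mul_mem_graded ha hb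
  d := d w δ
  d_mem h := d_mem w δ hδ h
  d_d := d_d w δ hδ hδδ
  leibniz b ha := leibniz w δ b ha

end Semifree

/-! ## The dg algebras of lens spaces -/

namespace LensDGA

/-- The generators of `C_{p,q}`. -/
inductive CGen : Type
  | x
  | y
  | z

/-- The generators of `E`. -/
inductive EGen : Type
  | α
  | γ

/-- `|x| = 0`, `|y| = -1`, `|z| = -2`. -/
def cDeg : CGen → ℤ
  | .x => 0
  | .y => -1
  | .z => -2

/-- `|α| = 0`, `|γ| = -2`. -/
def eDeg : EGen → ℤ
  | .α => 0
  | .γ => -2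

variable (k : Type u) [CommRing k]

/-- `dx = 0`, `dy = 1 - x ^ p`, `dz = x ^ q y - y x ^ q`. -/
noncomputable def cDiff (p q : ℕ) : CGen → FreeAlgebra k CGen
  | .x => 0
  | .y => 1 - FreeAlgebra.ι k .x ^ p
  | .z => FreeAlgebra.ι k .x ^ q * FreeAlgebra.ι k .y - FreeAlgebra.ι k .y * FreeAlgebra.ι k .x ^ q

theorem x_pow_mem (n : ℕ) : FreeAlgebra.ι k CGen.x ^ n ∈ Semifree.deg k cDeg 0 := by
  have := SetLike.pow_mem_graded n (wordDeg_gen (k := k) (FreeAlgebra.ι k) cDeg CGen.x)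
  simpa [cDeg] using this

theorem cDiff_mem (p q : ℕ) (i : CGen) : cDiff k p q i ∈ Semifree.deg k cDeg (cDeg i + 1) := by
  have hy := wordDeg_gen (k := k) (FreeAlgebra.ι k) cDeg CGen.y
  cases i with
  | x => exact zero_mem _
  | y => exact sub_mem (SetLike.one_mem_graded (Semifree.deg k cDeg)) (x_pow_mem k p)
  | z =>
    have h1 := SetLike.mul_mem_graded (x_pow_mem k q) hy
    have h2 := SetLike.mul_mem_graded hy (x_pow_mem k q)
    rw [zero_add] at h1
    rw [add_zero] at h2
    exact sub_mem h1 h2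

theorem d_x_pow (p q n : ℕ) :
    Semifree.d cDeg (cDiff k p q) (FreeAlgebra.ι k CGen.x ^ n) = 0 := by
  induction n with
  | zero => simp [Semifree.d_one]
  | succ n ih =>
    rw [pow_succ, Semifree.leibniz _ _ _ (x_pow_mem k n), ih, Semifree.d_ι]
    simp [cDiff]

theorem cDiff_closed (p q : ℕ) (i : CGen) :
    Semifree.d cDeg (cDiff k p q) (cDiff k p q i) = 0 := by
  have hy := wordDeg_gen (k := k) (FreeAlgebra.ι k) cDeg CGen.y
  cases i with
  | x => exact map_zero _
  | y =>
    change Semifree.d cDeg (cDiff k p q) (1 - FreeAlgebra.ι k CGen.x ^ p) = 0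
    rw [map_sub, d_x_pow, Semifree.d_one, sub_zero]
  | z =>
    change Semifree.d cDeg (cDiff k p q) (FreeAlgebra.ι k CGen.x ^ q * FreeAlgebra.ι k CGen.y -
      FreeAlgebra.ι k CGen.y * FreeAlgebra.ι k CGen.x ^ q) = 0
    rw [map_sub, Semifree.leibniz _ _ _ (x_pow_mem k q), Semifree.leibniz _ _ _ hy, d_x_pow,
      Semifree.d_ι]
    simp only [cDiff, zero_mul, zero_add, mul_zero, smul_zero, add_zero, Int.negOnePow_zero,
      one_smul]
    rw [mul_sub, sub_mul, mul_one, one_mul, ← pow_add, ← pow_add, add_comm p q, sub_self]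

/-- `C_{p,q}`: the semifree dga `k⟨x, y, z⟩` with the degrees and differentials above. -/
noncomputable def cDGA (p q : ℕ) : DGAlgStruct k (FreeAlgebra k CGen) :=
  Semifree.dga cDeg (cDiff k p q) (cDiff_mem k p q) (cDiff_closed k p q)

/-- `C_{p,q}` as a dg category with one object. -/
noncomputable def C (p q : ℕ) : DGCat k := (cDGA k p q).toDGCat

/-- The relations `α ^ p = 1` and `α γ = γ α`. -/
inductive ERel (p : ℕ) : FreeAlgebra k EGen → FreeAlgebra k EGen → Prop
  | pow : ERel p (FreeAlgebra.ι k .α ^ p) 1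
  | comm : ERel p (FreeAlgebra.ι k .α * FreeAlgebra.ι k .γ)
      (FreeAlgebra.ι k .γ * FreeAlgebra.ι k .α)

/-- The algebra `k⟨α, γ⟩ / (α ^ p = 1, α γ = γ α)`. -/
abbrev EAlg (p : ℕ) : Type u := RingQuot (ERel k p)

/-- The generators of `E` in the quotient algebra. -/
noncomputable def eGen (p : ℕ) (i : EGen) : EAlg k p :=
  RingQuot.mkAlgHom k (ERel k p) (FreeAlgebra.ι k i)

theorem eGen_pow (p : ℕ) : eGen k p .α ^ p = 1 := by
  rw [eGen, ← map_pow, RingQuot.mkAlgHom_rel k (ERel.pow (k := k) (p := p)), map_one]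

theorem eGen_comm (p : ℕ) : eGen k p .α * eGen k p .γ = eGen k p .γ * eGen k p .α := by
  rw [eGen, eGen, ← map_mul, RingQuot.mkAlgHom_rel k (ERel.comm (k := k) (p := p)), map_mul]

/-- The generators of `E` placed in their degrees. -/
noncomputable def eLift (p : ℕ) (i : EGen) : DirectSum ℤ fun n => wordDeg k (eGen k p) eDeg n :=
  DirectSum.of (fun n => wordDeg k (eGen k p) eDeg n) (eDeg i) ⟨eGen k p i, wordDeg_gen _ eDeg i⟩

theorem eLift_rel (p : ℕ) ⦃a b : FreeAlgebra k EGen⦄ (h : ERel k p a b) :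
    FreeAlgebra.lift k (eLift k p) a = FreeAlgebra.lift k (eLift k p) b := by
  cases h with
  | pow =>
    simp only [map_pow, FreeAlgebra.lift_ι_apply, map_one, eLift]
    rw [DirectSum.ofPow]
    refine DirectSum.of_eq_of_gradedMonoid_eq (Sigma.subtype_ext ?_ ?_)
    · change p • (0 : ℤ) = 0
      simp
    · exact eGen_pow k p
  | comm =>
    simp only [map_mul, FreeAlgebra.lift_ι_apply, eLift]
    rw [DirectSum.of_mul_of, DirectSum.of_mul_of]
    refine DirectSum.of_eq_of_gradedMonoid_eq (Sigma.subtype_ext ?_ ?_)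
    · rfl
    · exact eGen_comm k p

theorem e_isInternal (p : ℕ) : DirectSum.IsInternal (wordDeg k (eGen k p) eDeg) := by
  refine wordDeg_isInternal _ eDeg ?_
    (RingQuot.liftAlgHom k ⟨FreeAlgebra.lift k (eLift k p), eLift_rel k p⟩) ?_
  · intro f hf
    refine RingQuot.ringQuot_ext' k _ _ (FreeAlgebra.hom_ext (funext fun i => ?_))
    simpa [eGen] using hf i
  · intro i
    simp [eGen, eLift]

/-- The dga `E`, with zero differential. -/
noncomputable def eDGA (p : ℕ) : DGAlgStruct k (EAlg k p) where
  deg := wordDeg k (eGen k p) eDeg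
  isInternal := e_isInternal k p
  one_mem := SetLike.one_mem_graded _
  mul_mem ha hb := SetLike.mul_mem_graded ha hb
  d := 0
  d_mem _ := zero_mem _
  d_d _ := rfl
  leibniz _ _ := by simp [Units.smul_def]

/-- `E` as a dg category with one object. -/
noncomputable def E (p : ℕ) : DGCat k := (eDGA k p).toDGCat

/-- `π x = α`, `π y = 0`, `π z = γ` on generators. -/
noncomputable def piGen (p : ℕ) : CGen → EAlg k p
  | .x => eGen k p .α
  | .y => 0
  | .z => eGen k p .γ

/-- The algebra map underlying `π`. -/
noncomputable def piAlgHom (p : ℕ) : FreeAlgebra k CGen →ₐ[k] EAlg k p :=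
  FreeAlgebra.lift k (piGen k p)

theorem piGen_mem (p : ℕ) (i : CGen) : piGen k p i ∈ wordDeg k (eGen k p) eDeg (cDeg i) := by
  cases i with
  | x => exact wordDeg_gen (eGen k p) eDeg .α
  | y => exact zero_mem _
  | z => exact wordDeg_gen (eGen k p) eDeg .γ

theorem pi_mem (p q : ℕ) (n : ℤ) (a : FreeAlgebra k CGen) (ha : a ∈ (cDGA k p q).deg n) :
    piAlgHom k p a ∈ (eDGA k p).deg n := by
  change a ∈ wordDeg k (FreeAlgebra.ι k) cDeg n at ha
  change piAlgHom k p a ∈ wordDeg k (eGen k p) eDeg n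
  induction ha using Submodule.span_induction with
  | mem x h =>
    obtain ⟨l, rfl, rfl⟩ := h
    induction l with
    | nil => simpa using SetLike.one_mem_graded (wordDeg k (eGen k p) eDeg)
    | cons i l ih =>
      simp only [List.map_cons, List.prod_cons, List.sum_cons, map_mul]
      refine SetLike.mul_mem_graded ?_ ih
      simpa [piAlgHom] using piGen_mem k p i
  | zero => simp
  | add x y _ _ hx hy => rw [map_add]; exact add_mem hx hy
  | smul c x _ hx => rw [map_smul]; exact Submodule.smul_mem _ _ hx

theorem pi_d (p q : ℕ) (a : FreeAlgebra k CGen) :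
    piAlgHom k p ((cDGA k p q).d a) = (eDGA k p).d (piAlgHom k p a) := by
  change piAlgHom k p (Semifree.d cDeg (cDiff k p q) a) = 0
  have hgen : ∀ i, piAlgHom k p (cDiff k p q i) = 0 := by
    intro i
    cases i <;> simp [cDiff, piAlgHom, piGen, eGen_pow]
  have hleft : ∀ a b : FreeAlgebra k CGen, piAlgHom k p (Semifree.d cDeg (cDiff k p q) b) = 0 →
      piAlgHom k p (Semifree.d cDeg (cDiff k p q) (a * b)) = 0 := by
    intro a
    induction a using FreeAlgebra.induction with
    | grade0 r => intro b hb; rw [← Algebra.smul_def, map_smul, map_smul, hb, smul_zero]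
    | grade1 i =>
      intro b hb
      rw [Semifree.leibniz _ _ _ (wordDeg_gen _ cDeg i), Semifree.d_ι, map_add, map_mul, hgen,
        Units.smul_def, map_zsmul, map_mul, hb]
      simp
    | mul a a' ha ha' => intro b hb; rw [mul_assoc]; exact ha _ (ha' b hb)
    | add a a' ha ha' => intro b hb; rw [add_mul, map_add, map_add, ha b hb, ha' b hb, add_zero]
  simpa using hleft a 1 (by simp [Semifree.d_one])

/-- The dga morphism `π : C_{p,q} → E` with `π x = α`, `π y = 0`, `π z = γ`. -/
noncomputable def π (p q : ℕ) : DGFunctor (C k p q) (E k p) :=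
  DGAlgStruct.functorOfAlgHom (cDGA k p q) (eDGA k p) (piAlgHom k p) (pi_mem k p q) (pi_d k p q)

end LensDGA

/-! Write `C` for the dg algebra and `w` for `polyGen`, a cocycle of degree -2. The core of the
proof is that right multiplication by `w` accounts for all cohomology in negative degrees.

Consider the left ideal `cycIdeal` with generators e = x^p - 1, y_j = y x^(qj) and z_j = z x^(qj)
for 0 ≤ j < p. As q is invertible mod p, it contains every word involving y or z, hence everything
of negative degree. The differential sends y_0 to -e and z_j to x^q y_j - y_(j+1), so e cancels
against y_0 and y_(j+1) against z_j for j < p - 1. Only z_(p-1) survives. There y_p is not a new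
generator but equals y_0 + y N e with N = (x^(pq) - 1)/(x^p - 1), and correcting for this turns
z_(p-1) into `w`. Thus the ideal retracts, up to homotopy, onto `C w` (`exists_homotopy`).

A cocycle of negative degree is therefore a w + exact, with a a cocycle of degree higher by 2.
Iterating, every homogeneous cocycle is a w^m + exact with a a polynomial in x (`cocycle_eq`), and a
is exact once it vanishes mod x^p - 1 (`exact_of_toCyc_eq_zero`).

Finally π(x^q w) = pγ: the p summands of `zSum` have the same image, and y dies. If π kills a w^m,
then p^m π(a) γ^m = 0, so a vanishes mod x^p - 1 as soon as p is not a zero divisor in k; this gives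
injectivity, in particular over ℤ. If p is invertible, γ lifts to the cocycle p⁻¹ x^q w and α to x,
which gives surjectivity. As the target does not depend on q, the last claim follows from the zigzag
through it. -/

/-! ### Signs and crossed maps on free algebras -/

namespace Semifree

variable {k : Type u} [CommRing k] {ι : Type} (w : ι → ℤ) (δ : ι → FreeAlgebra k ι)

/-- The algebra automorphism `a ↦ (-1)^|a| a`. -/
noncomputable def sign : FreeAlgebra k ι →ₐ[k] FreeAlgebra k ι :=
  FreeAlgebra.lift k fun i => (w i).negOnePow • FreeAlgebra.ι k i

@[simp]
theorem sign_ι (i : ι) :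
    sign w (FreeAlgebra.ι k i) = (w i).negOnePow • FreeAlgebra.ι k i := by
  simp [sign]

theorem sign_sign (a : FreeAlgebra k ι) : sign w (sign w a) = a := by
  have : (sign w).comp (sign w) = AlgHom.id k _ := FreeAlgebra.hom_ext (funext fun i => by
    rw [Function.comp_apply, Function.comp_apply, AlgHom.comp_apply, sign_ι,
      Units.smul_def, map_zsmul, sign_ι, ← Units.smul_def, smul_smul,
      Int.units_mul_self, one_smul, AlgHom.id_apply])
  exact DFunLike.congr_fun this a

theorem leibnizHom_zero_zero (a : FreeAlgebra k ι) : leibnizHom w δ a 0 0 = sign w a := by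
  induction a using FreeAlgebra.induction with
  | grade0 r => simp [Matrix.algebraMap_matrix_apply]
  | grade1 i => simp [leibnizHom]
  | mul a b ha hb =>
    simp [Matrix.mul_apply, Fin.sum_univ_two, ha, hb, (leibnizHom_entries w δ b).1]
  | add a b ha hb => simp [ha, hb]

theorem sign_of_mem {n : ℤ} {a : FreeAlgebra k ι} (ha : a ∈ deg k w n) :
    sign w a = n.negOnePow • a := by
  rw [← leibnizHom_zero_zero w (fun _ => 0), leibnizHom_sign w _ ha]

/-- With the sign as an algebra map, the Leibniz rule needs no homogeneity, so later identities can
be checked on arbitrary elements. -/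
theorem d_mul (a b : FreeAlgebra k ι) :
    d w δ (a * b) = d w δ a * b + sign w a * d w δ b := by
  change leibnizHom w δ (a * b) 0 1 = leibnizHom w δ a 0 1 * b + _ * leibnizHom w δ b 0 1
  rw [map_mul, Matrix.mul_apply, Fin.sum_univ_two, leibnizHom_zero_zero,
    (leibnizHom_entries w δ b).2, add_comm]

theorem d_sign (hδ : ∀ i, δ i ∈ deg k w (w i + 1)) (a : FreeAlgebra k ι) :
    d w δ (sign w a) = -sign w (d w δ a) := by
  induction a using FreeAlgebra.induction with
  | grade0 r => simp [Algebra.algebraMap_eq_smul_one, d_one]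
  | grade1 i =>
    rw [sign_ι, d_ι, sign_of_mem w (hδ i), Int.negOnePow_succ, Units.neg_smul, neg_neg,
      Units.smul_def, Units.smul_def, map_zsmul, d_ι]
  | mul a b ha hb =>
    rw [map_mul, d_mul, ha, hb, d_mul, map_add, map_mul, map_mul]
    simp only [neg_mul, mul_neg, neg_add]
  | add a b ha hb => simp only [map_add, ha, hb, neg_add]

/-- Given an algebra map `ν` and arbitrary linear maps `κ i`, there is a map `f` satisfying
`f (g a) = σ g * f a + κ i (ν a)` for every generator `g`; it is `σ`-linear on the kernel
of `ν`. -/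
theorem exists_crossed {R : Type*} [Ring R] [Algebra k R]
    (σ : FreeAlgebra k ι →ₐ[k] FreeAlgebra k ι) (ν : FreeAlgebra k ι →ₐ[k] R)
    (κ : ι → R →ₗ[k] FreeAlgebra k ι) :
    ∃ f : FreeAlgebra k ι →ₗ[k] FreeAlgebra k ι, f 1 = 0 ∧
      (∀ i a, f (FreeAlgebra.ι k i * a) = σ (FreeAlgebra.ι k i) * f a + κ i (ν a)) ∧
      ∀ a b, ν b = 0 → f (a * b) = σ a * f b := by
  -- A representation by block triangular matrices: an extension of `R` (acted on through `ν`) by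
  -- the free algebra (acted on through `σ`), with `κ` as off-diagonal entry. Freeness allows any
  -- `κ`; `f a` is the first component of `a` acting on `(0, 1)`.
  let T : FreeAlgebra k ι →ₐ[k] Module.End k (FreeAlgebra k ι × R) :=
    FreeAlgebra.lift k fun i => LinearMap.prod
      (LinearMap.mulLeft k (σ (FreeAlgebra.ι k i)) ∘ₗ LinearMap.fst k _ _ +
        κ i ∘ₗ LinearMap.snd k _ _)
      (LinearMap.mulLeft k (ν (FreeAlgebra.ι k i)) ∘ₗ LinearMap.snd k _ _)
  have hT : ∀ i v, T (FreeAlgebra.ι k i) v =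
      (σ (FreeAlgebra.ι k i) * v.1 + κ i v.2, ν (FreeAlgebra.ι k i) * v.2) := by
    intro i v
    simp [T]
  have h2 : ∀ a v, (T a v).2 = ν a * v.2 := by
    intro a
    induction a using FreeAlgebra.induction with
    | grade0 r => intro v; simp [Algebra.smul_def]
    | grade1 i => intro v; rw [hT]
    | mul a b ha hb => intro v; rw [map_mul, Module.End.mul_apply, ha, hb, map_mul, mul_assoc]
    | add a b ha hb => intro v; simp [ha, hb, add_mul]
  have h1 : ∀ a m, T a (m, 0) = (σ a * m, 0) := by
    intro a
    induction a using FreeAlgebra.induction with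
    | grade0 r => intro m; simp [Algebra.smul_def]
    | grade1 i => intro m; rw [hT]; simp
    | mul a b ha hb => intro m; rw [map_mul, Module.End.mul_apply, hb, ha, map_mul, mul_assoc]
    | add a b ha hb => intro m; simp [ha, hb, add_mul]
  refine ⟨LinearMap.fst k _ _ ∘ₗ LinearMap.applyₗ (0, 1) ∘ₗ T.toLinearMap, ?_, ?_, ?_⟩
  · simp
  · intro i a
    simp [hT, h2]
  · intro a b hb
    have h : T b (0, 1) = ((T b (0, 1)).1, 0) := Prod.ext rfl (by rw [h2, hb, zero_mul])
    simp only [LinearMap.comp_apply, AlgHom.toLinearMap_apply, LinearMap.applyₗ_apply_apply,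
      LinearMap.fst_apply, map_mul, Module.End.mul_apply]
    rw [h, h1]

end Semifree

/-! ### The map to the group algebra of ℤ/p and semilinear maps on its kernel -/

namespace LensDGA

variable (k : Type u) [CommRing k]

/-- The generator `x`. -/
noncomputable abbrev X : FreeAlgebra k CGen := FreeAlgebra.ι k .x

/-- The generator `y`. -/
noncomputable abbrev Y : FreeAlgebra k CGen := FreeAlgebra.ι k .y

/-- The generator `z`. -/
noncomputable abbrev Z : FreeAlgebra k CGen := FreeAlgebra.ι k .z

/-- The differential of `C_{p,q}`. -/
noncomputable abbrev D (p q : ℕ) : FreeAlgebra k CGen →ₗ[k] FreeAlgebra k CGen :=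
  Semifree.d cDeg (cDiff k p q)

/-- The sign automorphism of the algebra underlying `C_{p,q}`. -/
noncomputable abbrev sgn : FreeAlgebra k CGen →ₐ[k] FreeAlgebra k CGen := Semifree.sign cDeg

/-- The group algebra of the cyclic group of order `p`. -/
abbrev CycAlg (p : ℕ) : Type u := AddMonoidAlgebra k (ZMod p)

/-- The linear map out of the group algebra with prescribed values on the group elements. -/
noncomputable def cycLift {k : Type u} [CommRing k] {p : ℕ} {M : Type*} [AddCommGroup M]
    [Module k M] (g : ZMod p → M) : CycAlg k p →ₗ[k] M :=
  Finsupp.linearCombination k g ∘ₗ (AddMonoidAlgebra.coeffLinearEquiv k).toLinearMap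

@[simp]
theorem cycLift_single {p : ℕ} {M : Type*} [AddCommGroup M]
    [Module k M] (g : ZMod p → M) (i : ZMod p) :
    cycLift g (AddMonoidAlgebra.single i (1 : k)) = g i := by
  simp [cycLift]

/-- The algebra map `x ↦ 1 ∈ ℤ/p`, `y, z ↦ 0` to the group algebra. -/
noncomputable def toCyc (p : ℕ) : FreeAlgebra k CGen →ₐ[k] CycAlg k p :=
  FreeAlgebra.lift k fun
    | .x => AddMonoidAlgebra.single 1 1
    | .y => 0
    | .z => 0

@[simp]
theorem toCyc_X (p : ℕ) : toCyc k p (X k) = AddMonoidAlgebra.single 1 1 := by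
  simp [toCyc]

@[simp]
theorem toCyc_Y (p : ℕ) : toCyc k p (Y k) = 0 := by
  simp [toCyc]

@[simp]
theorem toCyc_Z (p : ℕ) : toCyc k p (Z k) = 0 := by
  simp [toCyc]

theorem toCyc_X_pow (p n : ℕ) :
    toCyc k p (X k ^ n) = AddMonoidAlgebra.single (n : ZMod p) 1 := by
  rw [map_pow, toCyc_X, AddMonoidAlgebra.single_pow, one_pow, nsmul_one]

theorem toCyc_X_pow_self (p : ℕ) : toCyc k p (X k ^ p) = 1 := by
  rw [toCyc_X_pow, ZMod.natCast_self]; rfl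

theorem D_mul (p q : ℕ) (a b : FreeAlgebra k CGen) :
    D k p q (a * b) = D k p q a * b + sgn k a * D k p q b :=
  Semifree.d_mul _ _ a b

theorem D_sgn (p q : ℕ) (a : FreeAlgebra k CGen) : D k p q (sgn k a) = -sgn k (D k p q a) :=
  Semifree.d_sign _ _ (cDiff_mem k p q) a

theorem D_X (p q : ℕ) : D k p q (X k) = 0 := Semifree.d_ι _ _ _

theorem D_Y (p q : ℕ) : D k p q (Y k) = 1 - X k ^ p := Semifree.d_ι _ _ _

theorem D_Z (p q : ℕ) : D k p q (Z k) = X k ^ q * Y k - Y k * X k ^ q := Semifree.d_ι _ _ _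

theorem D_X_pow (p q n : ℕ) : D k p q (X k ^ n) = 0 := d_x_pow k p q n

@[simp]
theorem sgn_X : sgn k (X k) = X k := by simp [cDeg]

@[simp]
theorem sgn_Y : sgn k (Y k) = -Y k := by simp [cDeg]

theorem D_X_pow_mul (p q n : ℕ) (a : FreeAlgebra k CGen) :
    D k p q (X k ^ n * a) = X k ^ n * D k p q a := by
  rw [D_mul, D_X_pow, zero_mul, zero_add, map_pow, sgn_X]

theorem D_Y_mul_X_pow (p q n : ℕ) :
    D k p q (Y k * X k ^ n) = X k ^ n - X k ^ p * X k ^ n := by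
  rw [D_mul, D_X_pow, mul_zero, add_zero, D_Y, sub_mul, one_mul]

theorem D_Z_mul_X_pow (p q n : ℕ) :
    D k p q (Z k * X k ^ n) = X k ^ q * (Y k * X k ^ n) - Y k * X k ^ (q + n) := by
  rw [D_mul, D_X_pow, mul_zero, add_zero, D_Z, sub_mul, mul_assoc, mul_assoc, ← pow_add]

/-- Needed so that maps semilinear on the kernel of `toCyc` may also be applied to differentials. -/
theorem toCyc_D (p q : ℕ) (a : FreeAlgebra k CGen) : toCyc k p (D k p q a) = 0 := by
  induction a using FreeAlgebra.induction with
  | grade0 r => simp [Algebra.algebraMap_eq_smul_one, Semifree.d_one]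
  | grade1 i =>
    cases i with
    | x => rw [D_X, map_zero]
    | y => rw [D_Y, map_sub, map_one, toCyc_X_pow_self, sub_self]
    | z => rw [D_Z]; simp
  | mul a b ha hb => rw [D_mul]; simp [ha, hb]
  | add a b ha hb => simp [ha, hb]

variable {k}

/-- Maps which are `σ`-linear on the kernel of `toCyc` with prescribed values on the generators
`x ^ p - 1`, `y x ^ (q j)`, `z x ^ (q j)`, `j < p`, of this left ideal. -/
theorem exists_semilinear {p q : ℕ} (hp : 1 < p) (hpq : Nat.Coprime p q)
    (σ : FreeAlgebra k CGen →ₐ[k] FreeAlgebra k CGen)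
    (e : FreeAlgebra k CGen) (mY mZ : ℕ → FreeAlgebra k CGen) :
    ∃ f : FreeAlgebra k CGen →ₗ[k] FreeAlgebra k CGen,
      (∀ a b, toCyc k p b = 0 → f (a * b) = σ a * f b) ∧ f (X k ^ p - 1) = e ∧
      (∀ j < p, f (Y k * X k ^ (q * j)) = mY j) ∧ ∀ j < p, f (Z k * X k ^ (q * j)) = mZ j := by
  have : NeZero p := ⟨by omega⟩
  have : Fact (1 < p) := ⟨hp⟩
  -- The correction occurs only in passing from x^(p-1) to x^p, so `F n`, the value on x^n, is 0 for
  -- `n < p` and `e` for `n = p`.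
  let κ : ZMod p → FreeAlgebra k CGen := fun i => if i = -1 then e else 0
  let F : ℕ → FreeAlgebra k CGen := fun n => Nat.rec 0 (fun n a => σ (X k) * a + κ n) n
  -- Recovers j from the class of qj. Below, the terms in `F (q * J i)` compensate for `F (q * j)`,
  -- which need not vanish once `q * j ≥ p`.
  let J : ZMod p → ℕ := fun i => (i * (q : ZMod p)⁻¹).val
  have hJ : ∀ j < p, J ((q * j : ℕ) : ZMod p) = j := by
    intro j hj
    have hq : (q : ZMod p) * (q : ZMod p)⁻¹ = 1 := ZMod.coe_mul_inv_eq_one q hpq.symm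
    simp only [J, Nat.cast_mul]
    rw [mul_right_comm, hq, one_mul, ZMod.val_natCast, Nat.mod_eq_of_lt hj]
  obtain ⟨f, f1, fι, fl⟩ := Semifree.exists_crossed σ (toCyc k p) (fun
    | .x => cycLift κ
    | .y => cycLift fun i => mY (J i) - σ (Y k) * F (q * J i)
    | .z => cycLift fun i => mZ (J i) - σ (Z k) * F (q * J i))
  have hF : ∀ n, f (X k ^ n) = F n := by
    intro n
    induction n with
    | zero => rw [pow_zero, f1]; rfl
    | succ n ih => rw [pow_succ', fι, ih, toCyc_X_pow, cycLift_single]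
  have hF0 : ∀ n < p, F n = 0 := by
    intro n
    induction n with
    | zero => intro _; rfl
    | succ n ih =>
      intro hn
      change σ (X k) * F n + κ n = 0
      have : ((n : ZMod p) = -1) ↔ False := by
        rw [iff_false, eq_neg_iff_add_eq_zero, ← Nat.cast_succ, ZMod.natCast_eq_zero_iff]
        exact fun h => absurd (Nat.le_of_dvd (by omega) h) (by omega)
      rw [ih (by omega), mul_zero, zero_add]
      simp only [κ, this, if_false]
  have hFp : F p = e := by
    obtain ⟨m, rfl⟩ : ∃ m, p = m + 1 := ⟨p - 1, by omega⟩
    change σ (X k) * F m + κ m = e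
    have : (m : ZMod (m + 1)) = -1 := by
      rw [eq_neg_iff_add_eq_zero, ← Nat.cast_succ, ZMod.natCast_self]
    rw [hF0 m (by omega), mul_zero, zero_add]
    simp only [κ, this, if_true]
  refine ⟨f, fl, ?_, ?_, ?_⟩
  · rw [map_sub, f1, hF, hFp, sub_zero]
  · intro j hj
    rw [fι, hF, toCyc_X_pow, cycLift_single, hJ j hj, add_sub_cancel]
  · intro j hj
    rw [fι, hF, toCyc_X_pow, cycLift_single, hJ j hj, add_sub_cancel]

end LensDGA

/-! ### The cocycle of degree -2 and the retraction of the left ideal -/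

namespace LensDGA

variable (k : Type u) [CommRing k]

/-- The element `∑ i < j, x ^ (q (j - 1 - i)) z x ^ (q i)`, which bounds `[x ^ (q j), y]`. -/
noncomputable def zSum (q : ℕ) : ℕ → FreeAlgebra k CGen
  | 0 => 0
  | j + 1 => X k ^ q * zSum q j + Z k * X k ^ (q * j)

/-- The quotient of `x ^ (p q) - 1` by `x ^ p - 1`. -/
noncomputable def geomX (p q : ℕ) : FreeAlgebra k CGen := ∑ i ∈ Finset.range q, (X k ^ p) ^ i

/-- The cocycle of degree `-2` whose powers generate the cohomology over `k[x] / (x ^ p - 1)`. -/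
noncomputable def polyGen (p q : ℕ) : FreeAlgebra k CGen :=
  zSum k q p + Y k * (geomX k p q * Y k)

theorem geomX_mul (p q : ℕ) : geomX k p q * (X k ^ p - 1) = X k ^ (q * p) - 1 := by
  rw [geomX, geom_sum_mul, ← pow_mul, mul_comm]

theorem mul_geomX (p q : ℕ) : (X k ^ p - 1) * geomX k p q = X k ^ (q * p) - 1 := by
  rw [geomX, mul_geom_sum, ← pow_mul, mul_comm]

theorem D_zSum (p q j : ℕ) :
    D k p q (zSum k q j) = X k ^ (q * j) * Y k - Y k * X k ^ (q * j) := by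
  induction j with
  | zero => simp [zSum]
  | succ j ih =>
    rw [zSum, map_add, D_X_pow_mul, ih, D_Z_mul_X_pow, mul_add_one, add_comm (q * j), pow_add,
      mul_sub]
    noncomm_ring

theorem D_geomX (p q r : ℕ) : D k p q (geomX k p r) = 0 := by
  rw [geomX, map_sum]
  exact Finset.sum_eq_zero fun i _ => by rw [← pow_mul, D_X_pow]

theorem sgn_geomX (p r : ℕ) : sgn k (geomX k p r) = geomX k p r := by
  rw [geomX, map_sum]
  exact Finset.sum_congr rfl fun i _ => by rw [map_pow, map_pow, sgn_X]

/-- The first summand contributes the commutator of x^(pq) with y; the second cancels it because 1 -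
x^p times the geometric sum is 1 - x^(pq) on either side. -/
theorem D_polyGen (p q : ℕ) : D k p q (polyGen k p q) = 0 := by
  rw [polyGen, map_add, D_zSum, D_mul, D_mul, D_geomX, D_Y, sgn_geomX, sgn_Y, zero_mul, zero_add,
    ← mul_assoc, ← neg_sub (X k ^ p), neg_mul, mul_geomX, mul_neg, geomX_mul]
  noncomm_ring

variable {k} in
theorem mul_mem_deg {m n l : ℤ} {a b : FreeAlgebra k CGen} (ha : a ∈ Semifree.deg k cDeg m)
    (hb : b ∈ Semifree.deg k cDeg n) (h : m + n = l) : a * b ∈ Semifree.deg k cDeg l :=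
  h ▸ SetLike.mul_mem_graded ha hb

theorem polyGen_mem (p q : ℕ) : polyGen k p q ∈ Semifree.deg k cDeg (-2) := by
  have hY : Y k ∈ Semifree.deg k cDeg (-1) := wordDeg_gen _ cDeg CGen.y
  have hZ : Z k ∈ Semifree.deg k cDeg (-2) := wordDeg_gen _ cDeg CGen.z
  refine add_mem ?_ ?_
  · have h : ∀ j, zSum k q j ∈ Semifree.deg k cDeg (-2) := by
      intro j
      induction j with
      | zero => exact zero_mem _
      | succ j ih =>
        exact add_mem (mul_mem_deg (x_pow_mem k q) ih (zero_add _))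
          (mul_mem_deg hZ (x_pow_mem k (q * j)) (add_zero _))
    exact h p
  · have hN : geomX k p q ∈ Semifree.deg k cDeg 0 :=
      sum_mem fun i _ => by rw [← pow_mul]; exact x_pow_mem k _
    exact mul_mem_deg hY (mul_mem_deg hN hY (zero_add _)) (by norm_num)

/-- The left ideal generated by `x ^ p - 1` and the `y x ^ (q j)`, `z x ^ (q j)` with `j < p`. -/
noncomputable def cycIdeal (p q : ℕ) : Ideal (FreeAlgebra k CGen) :=
  Ideal.span {b | b = X k ^ p - 1 ∨ ∃ j < p, b = Y k * X k ^ (q * j) ∨ b = Z k * X k ^ (q * j)}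

variable {k}

theorem X_pow_sub_mem_cycIdeal {p q m n : ℕ} (h : m ≡ n [MOD p]) :
    X k ^ m - X k ^ n ∈ cycIdeal k p q := by
  have key : ∀ m t, X k ^ (m + p * t) - X k ^ m ∈ cycIdeal k p q := by
    intro m t
    have : X k ^ (m + p * t) - X k ^ m = (X k ^ m * geomX k p t) * (X k ^ p - 1) := by
      rw [mul_assoc, geomX_mul, mul_comm p t, pow_add, mul_sub, mul_one]
    rw [this]
    exact Ideal.mul_mem_left _ _ (Ideal.subset_span (Or.inl rfl))
  rcases le_total m n with hmn | hmn
  · obtain ⟨t, ht⟩ := (Nat.modEq_iff_dvd' hmn).1 h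
    rw [show n = m + p * t by omega, ← neg_sub]
    exact neg_mem (key m t)
  · obtain ⟨t, ht⟩ := (Nat.modEq_iff_dvd' hmn).1 h.symm
    rw [show m = n + p * t by omega]
    exact key n t

/-- Coprimality gives n ≡ qj mod p with j < p, and x^n - x^(qj) is a left multiple of x^p - 1. -/
theorem gen_mul_X_pow_mem_cycIdeal {p q : ℕ} (hp : 0 < p) (hpq : Nat.Coprime p q) (n : ℕ) :
    Y k * X k ^ n ∈ cycIdeal k p q ∧ Z k * X k ^ n ∈ cycIdeal k p q := by
  have : NeZero p := ⟨by omega⟩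
  obtain ⟨j, hj, hjn⟩ : ∃ j < p, n ≡ q * j [MOD p] := by
    refine ⟨((n : ZMod p) * (q : ZMod p)⁻¹).val, ZMod.val_lt _, ?_⟩
    rw [← ZMod.natCast_eq_natCast_iff, Nat.cast_mul, ZMod.natCast_zmod_val, mul_left_comm,
      ZMod.coe_mul_inv_eq_one q hpq.symm, mul_one]
  have h := X_pow_sub_mem_cycIdeal (k := k) (q := q) hjn
  constructor
  · have h1 := Ideal.mul_mem_left _ (Y k) h
    rw [mul_sub] at h1
    exact (Submodule.sub_mem_iff_left (cycIdeal k p q)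
      (Ideal.subset_span (Or.inr ⟨j, hj, Or.inl rfl⟩))).1 h1
  · have h1 := Ideal.mul_mem_left _ (Z k) h
    rw [mul_sub] at h1
    exact (Submodule.sub_mem_iff_left (cycIdeal k p q)
      (Ideal.subset_span (Or.inr ⟨j, hj, Or.inr rfl⟩))).1 h1

theorem toCyc_of_mem_cycIdeal {p q : ℕ} {b : FreeAlgebra k CGen} (hb : b ∈ cycIdeal k p q) :
    toCyc k p b = 0 := by
  induction hb using Submodule.span_induction with
  | mem b h =>
    rcases h with rfl | ⟨j, _, rfl | rfl⟩
    · rw [map_sub, toCyc_X_pow_self, map_one, sub_self]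
    · rw [map_mul, toCyc_Y, zero_mul]
    · rw [map_mul, toCyc_Z, zero_mul]
  | zero => exact map_zero _
  | add a b _ _ ha hb => rw [map_add, ha, hb, add_zero]
  | smul a b _ hb => rw [smul_eq_mul, map_mul, hb, mul_zero]

/-- The left ideal `cycIdeal` retracts onto the left submodule generated by `polyGen`. -/
theorem exists_homotopy {p q : ℕ} (hp : 1 < p) (hpq : Nat.Coprime p q) :
    ∃ H P : FreeAlgebra k CGen →ₗ[k] FreeAlgebra k CGen, ∀ b ∈ cycIdeal k p q,
      D k p q (H b) + H (D k p q b) + P b * polyGen k p q = b ∧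
        D k p q (P b) = P (D k p q b) := by
  -- `H` inverts the cancelling part of the differential: -y bounds x^p - 1, and -`zSum` bounds y
  -- x^(qj) - x^(qj) y. `P` reads off the coefficient of the one surviving generator, z x^(q(p-1)).
  obtain ⟨H, Hl, He, HY, HZ⟩ := exists_semilinear hp hpq (sgn k) (-Y k)
    (fun j => -zSum k q j) (fun _ => 0)
  obtain ⟨P, Pl, Pe, PY, PZ⟩ := exists_semilinear hp hpq (AlgHom.id k _) 0
    (fun _ => 0) (fun j => if j + 1 = p then 1 else 0)
  have he : toCyc k p (X k ^ p - 1) = 0 := by rw [map_sub, toCyc_X_pow_self, map_one, sub_self]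
  have hY : ∀ n, toCyc k p (Y k * X k ^ n) = 0 := fun n => by rw [map_mul, toCyc_Y, zero_mul]
  have hDY : ∀ n, D k p q (Y k * X k ^ n) = -X k ^ n * (X k ^ p - 1) := fun n => by
    rw [D_Y_mul_X_pow, ← pow_add, add_comm, pow_add]; noncomm_ring
  -- The index j = p wraps around to j = 0; the error term is the source of the y N y summand of
  -- `polyGen`.
  have hYp : Y k * X k ^ (q * p) = Y k * X k ^ (q * 0) + Y k * geomX k p q * (X k ^ p - 1) := by
    rw [mul_assoc, geomX_mul]; simp [mul_sub]
  have HYp : H (Y k * X k ^ (q * p)) = Y k * (geomX k p q * Y k) := by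
    rw [hYp, map_add, HY 0 (by omega), Hl _ _ he, He, map_mul, sgn_Y, sgn_geomX, zSum]
    noncomm_ring
  have PYp : P (Y k * X k ^ (q * p)) = 0 := by
    rw [hYp, map_add, PY 0 (by omega), Pl _ _ he, Pe, mul_zero, add_zero]
  refine ⟨H, P, fun b hb => ?_⟩
  induction hb using Submodule.span_induction with
  | mem b h =>
    rcases h with rfl | ⟨j, hj, rfl | rfl⟩
    · have hD : D k p q (X k ^ p - 1) = 0 := by
        rw [map_sub, D_X_pow]; simp [Semifree.d_one]
      rw [He, Pe, hD, map_zero, map_zero, map_zero, map_neg, D_Y]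
      simp
    · rw [HY j hj, PY j hj, hDY, Hl _ _ he, Pl _ _ he, He, Pe, map_neg, D_zSum, map_neg, map_pow,
        sgn_X]
      simp
    · rw [HZ j hj, PZ j hj, D_Z_mul_X_pow, map_sub, map_sub, Hl _ _ (hY _), Pl _ _ (hY _),
        HY j hj, PY j hj, map_pow, sgn_X, ← mul_one_add, add_comm 1 j]
      by_cases h : j + 1 = p
      · rw [if_pos h, h, HYp, PYp, polyGen, ← h, zSum]
        constructor
        · simp only [map_zero, one_mul]; noncomm_ring
        · simp [Semifree.d_one]
      · rw [if_neg h, HY (j + 1) (by omega), PY (j + 1) (by omega), zSum]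
        simp
  | zero => simp
  | add a b _ _ ha hb =>
    simp only [map_add, add_mul, ha.2, hb.2, and_true]
    conv_rhs => rw [← ha.1, ← hb.1]
    abel
  | smul a b hb h =>
    -- Left multiplication: in D H + H D the two terms containing the differential of a cancel,
    -- since `D` anticommutes with the sign and the sign is an involution.
    have hb0 := toCyc_of_mem_cycIdeal hb
    have hDb := toCyc_D k p q b
    rw [smul_eq_mul, Hl _ _ hb0, Pl _ _ hb0, D_mul k p q a b, map_add, map_add, Hl _ _ hb0,
      Pl _ _ hb0, Hl _ _ hDb, Pl _ _ hDb, D_mul, D_mul, ← h.2]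
    refine ⟨?_, rfl⟩
    have hs : sgn k (sgn k a) = a := Semifree.sign_sign cDeg a
    conv_rhs => rw [← h.1]
    rw [D_sgn, hs, AlgHom.id_apply]
    noncomm_ring

end LensDGA

/-! ### Injectivity and surjectivity on cohomology in terms of representatives -/

namespace DGFunctor

variable {k : Type u} [CommRing k] {C D : DGCat k}

theorem cohomologyMap_injective (F : DGFunctor C D) {A B : C.Obj} {n : ℤ}
    (h : ∀ f ∈ C.cocycles A B n, F.map A B f ∈ D.coboundaries (F.obj A) (F.obj B) n →
      f ∈ C.coboundaries A B n) : Function.Injective (F.cohomologyMap A B n) := by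
  rw [injective_iff_map_eq_zero]
  intro a ha
  obtain ⟨⟨f, hf⟩, rfl⟩ := Submodule.Quotient.mk_surjective _ a
  refine (Submodule.Quotient.mk_eq_zero _).2 (h f hf ?_)
  exact (Submodule.Quotient.mk_eq_zero
    ((D.coboundaries _ _ n).submoduleOf (D.cocycles (F.obj A) (F.obj B) n))).1 ha

theorem cohomologyMap_surjective (F : DGFunctor C D) {A B : C.Obj} {n : ℤ}
    (h : ∀ g ∈ D.cocycles (F.obj A) (F.obj B) n, ∃ f ∈ C.cocycles A B n, F.map A B f = g) :
    Function.Surjective (F.cohomologyMap A B n) := by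
  intro b
  obtain ⟨⟨g, hg⟩, rfl⟩ := Submodule.Quotient.mk_surjective _ b
  obtain ⟨f, hf, rfl⟩ := h g hg
  exact ⟨Submodule.Quotient.mk ⟨f, hf⟩, rfl⟩

end DGFunctor

/-! ### Degrees, and the normal form of cocycles -/

namespace LensDGA

variable {k : Type u} [CommRing k]

theorem word_cases {p q : ℕ} (hp : 0 < p) (hpq : Nat.Coprime p q) (l : List CGen) :
    ((l.map (FreeAlgebra.ι k)).prod ∈ cycIdeal k p q ∧ (l.map cDeg).sum < 0) ∨
      ∃ n, (l.map (FreeAlgebra.ι k)).prod = X k ^ n ∧ (l.map cDeg).sum = 0 := by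
  induction l with
  | nil => exact Or.inr ⟨0, by simp⟩
  | cons i l ih =>
    have hi : cDeg i ≤ 0 := by cases i <;> simp [cDeg]
    simp only [List.map_cons, List.prod_cons, List.sum_cons]
    rcases ih with ⟨h1, h2⟩ | ⟨n, h1, h2⟩
    · exact Or.inl ⟨Ideal.mul_mem_left _ _ h1, by omega⟩
    · rw [h1, h2]
      have h := gen_mul_X_pow_mem_cycIdeal (k := k) hp hpq n
      cases i with
      | x => exact Or.inr ⟨n + 1, (pow_succ' _ _).symm, rfl⟩
      | y => exact Or.inl ⟨h.1, by decide⟩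
      | z => exact Or.inl ⟨h.2, by decide⟩

theorem eq_zero_of_deg_pos {n : ℤ} (hn : 0 < n) {c : FreeAlgebra k CGen}
    (hc : c ∈ Semifree.deg k cDeg n) : c = 0 := by
  have : Semifree.deg k cDeg n ≤ ⊥ := by
    refine Submodule.span_le.2 ?_
    rintro _ ⟨l, hl, rfl⟩
    -- Only the degree of the word matters here, so any coprime pair serves.
    rcases word_cases (k := k) (p := 1) (q := 1) one_pos (by norm_num) l with ⟨_, h⟩ | ⟨_, _, h⟩ <;>
      omega
  exact this hc

theorem mem_cycIdeal_of_deg_neg {p q : ℕ} (hp : 0 < p) (hpq : Nat.Coprime p q) {n : ℤ}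
    (hn : n < 0) {c : FreeAlgebra k CGen} (hc : c ∈ Semifree.deg k cDeg n) :
    c ∈ cycIdeal k p q := by
  have : Semifree.deg k cDeg n ≤ (cycIdeal k p q).restrictScalars k := by
    refine Submodule.span_le.2 ?_
    rintro _ ⟨l, hl, rfl⟩
    rcases word_cases (k := k) hp hpq l with ⟨h, _⟩ | ⟨_, _, h⟩
    · exact h
    · omega
  exact this hc

theorem deg_zero_le_span :
    Semifree.deg k cDeg 0 ≤ Submodule.span k (Set.range (X k ^ · : ℕ → _)) := by
  refine Submodule.span_mono ?_
  rintro _ ⟨l, hl, rfl⟩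
  rcases word_cases (k := k) (p := 1) (q := 1) one_pos (by norm_num) l with ⟨_, h⟩ | ⟨n, h, _⟩
  · omega
  · exact ⟨n, h.symm⟩

/-- The grading of the algebra underlying `C_{p,q}`. -/
@[reducible]
noncomputable def gradedRing : GradedRing (Semifree.deg k cDeg) :=
  { (Semifree.isInternal cDeg).chooseDecomposition, wordDeg_gradedMonoid _ _ with }

/-- The homogeneous component of degree `n`. -/
noncomputable def component (n : ℤ) : FreeAlgebra k CGen →+ FreeAlgebra k CGen :=
  letI := gradedRing (k := k)
  GradedRing.proj (Semifree.deg k cDeg) n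

theorem component_mem (n : ℤ) (a : FreeAlgebra k CGen) :
    component n a ∈ Semifree.deg k cDeg n :=
  letI := gradedRing (k := k)
  SetLike.coe_mem (DirectSum.decompose (Semifree.deg k cDeg) a n)

theorem component_of_mem {n : ℤ} {a : FreeAlgebra k CGen} (ha : a ∈ Semifree.deg k cDeg n) :
    component n a = a :=
  letI := gradedRing (k := k)
  DirectSum.decompose_of_mem_same _ ha

theorem component_of_mem_ne {m n : ℤ} {a : FreeAlgebra k CGen} (ha : a ∈ Semifree.deg k cDeg m)
    (h : m ≠ n) : component n a = 0 :=
  letI := gradedRing (k := k)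
  DirectSum.decompose_of_mem_ne _ ha h

theorem component_mul {i n : ℤ} (a : FreeAlgebra k CGen) {b : FreeAlgebra k CGen}
    (hb : b ∈ Semifree.deg k cDeg i) : component (n + i) (a * b) = component n a * b :=
  letI := gradedRing (k := k)
  DirectSum.coe_decompose_mul_add_of_right_mem _ hb

theorem component_D (p q : ℕ) (n : ℤ) (a : FreeAlgebra k CGen) :
    component (n + 1) (D k p q a) = D k p q (component n a) := by
  let := gradedRing (k := k)
  induction a using DirectSum.Decomposition.inductionOn (Semifree.deg k cDeg) with
  | zero => simp
  | @homogeneous i a =>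
    have hD : D k p q (a : FreeAlgebra k CGen) ∈ Semifree.deg k cDeg (i + 1) :=
      (cDGA k p q).d_mem a.2
    by_cases h : i = n
    · subst h
      rw [component_of_mem hD, component_of_mem a.2]
    · rw [component_of_mem_ne hD (by omega), component_of_mem_ne a.2 h, map_zero]
  | add a b ha hb => simp only [map_add, ha, hb]

/-- On a cocycle the homotopy formula reads c = D (H c) + P c * `polyGen`, with P c closed. Nothing
is known about the degrees of `H` and `P`, so homogeneous components are taken afterwards. -/
theorem cocycle_step {p q : ℕ} (hp : 1 < p) (hpq : Nat.Coprime p q) {n : ℤ} (hn : n < 0)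
    {c : FreeAlgebra k CGen} (hc : c ∈ Semifree.deg k cDeg n) (hDc : D k p q c = 0) :
    ∃ a ∈ Semifree.deg k cDeg (n + 2), D k p q a = 0 ∧
      ∃ h, c = a * polyGen k p q + D k p q h := by
  obtain ⟨H, P, hHP⟩ := exists_homotopy (k := k) hp hpq
  obtain ⟨h1, h2⟩ := hHP c (mem_cycIdeal_of_deg_neg (by omega) hpq hn hc)
  rw [hDc, map_zero, add_zero] at h1
  rw [hDc, map_zero] at h2
  refine ⟨component (n + 2) (P c), component_mem _ _, ?_, component (n - 1) (H c), ?_⟩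
  · rw [← component_D, h2, map_zero]
  · rw [← component_D, ← component_mul _ (polyGen_mem k p q), ← sub_eq_add_neg, add_sub_cancel_right,
      sub_add_cancel, ← map_add, add_comm, h1, component_of_mem hc]

theorem D_mul_polyGen_pow (p q m : ℕ) (a : FreeAlgebra k CGen) :
    D k p q (a * polyGen k p q ^ m) = D k p q a * polyGen k p q ^ m := by
  induction m with
  | zero => simp
  | succ m ih => rw [pow_succ, ← mul_assoc, D_mul, ih, D_polyGen, mul_zero, add_zero, mul_assoc]

theorem cocycle_eq {p q : ℕ} (hp : 1 < p) (hpq : Nat.Coprime p q) (n : ℤ)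
    {c : FreeAlgebra k CGen} (hc : c ∈ Semifree.deg k cDeg n) (hDc : D k p q c = 0) :
    ∃ a ∈ Semifree.deg k cDeg 0, ∃ m h, c = a * polyGen k p q ^ m + D k p q h := by
  -- Each step raises the degree by 2, and may pass from -1 to 1, where everything is zero.
  obtain ⟨N, hN⟩ : ∃ N : ℕ, -n ≤ N := ⟨(-n).toNat, Int.self_le_toNat _⟩
  induction N using Nat.strong_induction_on generalizing n c with
  | _ N ih =>
    rcases lt_trichotomy n 0 with h | rfl | h
    · obtain ⟨a, ha, hDa, e, rfl⟩ := cocycle_step hp hpq h hc hDc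
      obtain ⟨b, hb, m, f, rfl⟩ := ih (N - 1) (by omega) (n + 2) ha hDa (by omega)
      refine ⟨b, hb, m + 1, f * polyGen k p q ^ 1 + e, ?_⟩
      rw [map_add, D_mul_polyGen_pow, pow_one, pow_succ, add_mul, mul_assoc, add_assoc]
    · exact ⟨c, hc, 0, 0, by simp⟩
    · exact ⟨0, zero_mem _, 0, 0, by simp [eq_zero_of_deg_pos h hc]⟩

/-- In degree 0 there are only polynomials in x, and x^n is cohomologous to x^(n mod p) via a
multiple of y; so a is cohomologous to the normal form determined by its image in the group algebra.
-/
theorem exact_of_toCyc_eq_zero {p : ℕ} (q : ℕ) {a : FreeAlgebra k CGen}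
    (ha : a ∈ Semifree.deg k cDeg 0) (h : toCyc k p a = 0) : ∃ b, D k p q b = a := by
  let s : CycAlg k p →ₗ[k] FreeAlgebra k CGen := cycLift fun i => X k ^ i.val
  have key : Submodule.span k (Set.range (X k ^ · : ℕ → _)) ≤
      (LinearMap.range (D k p q)).comap (LinearMap.id - s ∘ₗ (toCyc k p).toLinearMap) := by
    refine Submodule.span_le.2 ?_
    rintro _ ⟨n, rfl⟩
    change X k ^ n - s (toCyc k p (X k ^ n)) ∈ LinearMap.range (D k p q)
    rw [toCyc_X_pow, cycLift_single, ZMod.val_natCast]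
    refine ⟨-(X k ^ (n % p) * (geomX k p (n / p) * Y k)), ?_⟩
    rw [map_neg, D_X_pow_mul, D_mul, D_geomX, sgn_geomX, D_Y, zero_mul, zero_add,
      ← neg_sub (X k ^ p), mul_neg, geomX_mul, mul_neg, neg_neg, mul_sub, mul_one, ← pow_add,
      mul_comm, Nat.mod_add_div]
  obtain ⟨b, hb⟩ := key (deg_zero_le_span ha)
  refine ⟨b, hb.trans ?_⟩
  simp [h]

/-! ### Comparison with `E` -/

/-- The algebra map from `E` to polynomials over the group algebra, `α ↦ 1 ∈ ℤ/p`, `γ ↦ T`. -/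
noncomputable def ePoly (k : Type u) [CommRing k] (p : ℕ) :
    EAlg k p →ₐ[k] Polynomial (CycAlg k p) :=
  RingQuot.liftAlgHom k ⟨FreeAlgebra.lift k fun
    | .α => Polynomial.C (AddMonoidAlgebra.single 1 1)
    | .γ => Polynomial.X, by
      intro a b h
      cases h with
      | pow =>
        rw [map_pow, FreeAlgebra.lift_ι_apply, ← map_pow, AddMonoidAlgebra.single_pow, one_pow,
          nsmul_one, ZMod.natCast_self, map_one]
        rfl
      | comm => rw [map_mul, map_mul, mul_comm]⟩

theorem ePoly_alpha (p : ℕ) :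
    ePoly k p (eGen k p .α) = Polynomial.C (AddMonoidAlgebra.single 1 1) := by
  simp [ePoly, eGen]

theorem ePoly_gamma (p : ℕ) : ePoly k p (eGen k p .γ) = Polynomial.X := by
  simp [ePoly, eGen]

theorem piAlgHom_X (p : ℕ) : piAlgHom k p (X k) = eGen k p .α := by
  simp [piAlgHom, piGen]

theorem piAlgHom_Y (p : ℕ) : piAlgHom k p (Y k) = 0 := by
  simp [piAlgHom, piGen]

theorem piAlgHom_Z (p : ℕ) : piAlgHom k p (Z k) = eGen k p .γ := by
  simp [piAlgHom, piGen]

theorem piAlgHom_D (p q : ℕ) (a : FreeAlgebra k CGen) : piAlgHom k p (D k p q a) = 0 :=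
  pi_d k p q a

/-- All p summands of `zSum` have image α^(q(p-1)) γ, as α and γ commute; the factor x^q completes
the exponent to pq, where α^p = 1 applies. -/
theorem piAlgHom_polyGen (p q : ℕ) :
    piAlgHom k p (X k ^ q * polyGen k p q) = (p : k) • eGen k p .γ := by
  have hc : ∀ n, eGen k p .γ * eGen k p .α ^ n = eGen k p .α ^ n * eGen k p .γ := fun n =>
    (Commute.pow_left (eGen_comm k p) n).symm
  have h : ∀ j, piAlgHom k p (X k ^ q * zSum k q j) =
      (j : k) • (eGen k p .α ^ (q * j) * eGen k p .γ) := by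
    intro j
    induction j with
    | zero => simp [zSum]
    | succ j ih =>
      rw [zSum, mul_add, map_add, map_mul, ih, ← mul_assoc, map_mul, map_mul, map_pow, map_pow,
        piAlgHom_X, piAlgHom_Z, mul_assoc, hc, ← mul_assoc, mul_smul_comm, ← mul_assoc,
        ← pow_add, Nat.cast_succ, add_smul, one_smul, mul_add_one, add_comm q]
  rw [polyGen, mul_add, map_add, h, pow_mul', eGen_pow, one_pow, one_mul, map_mul, map_mul,
    piAlgHom_Y, zero_mul, mul_zero, add_zero]

theorem ePoly_piAlgHom_deg_zero {p : ℕ} {a : FreeAlgebra k CGen}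
    (ha : a ∈ Semifree.deg k cDeg 0) :
    ePoly k p (piAlgHom k p a) = Polynomial.C (toCyc k p a) := by
  have ha' := deg_zero_le_span ha
  clear ha
  induction ha' using Submodule.span_induction with
  | mem a h =>
    obtain ⟨n, rfl⟩ := h
    simp only [map_pow, piAlgHom_X, ePoly_alpha, toCyc_X]
  | zero => simp
  | add a b _ _ ha hb => simp only [map_add, ha, hb]
  | smul r a _ ha => rw [map_smul, map_smul, ha, map_smul, Polynomial.smul_C]

theorem exact_of_piAlgHom_eq_zero {p q : ℕ} (hp : 1 < p) (hpq : Nat.Coprime p q)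
    (hreg : ∀ r : k, (p : k) * r = 0 → r = 0) {n : ℤ} {c : FreeAlgebra k CGen}
    (hc : c ∈ Semifree.deg k cDeg n) (hDc : D k p q c = 0) (hπ : piAlgHom k p c = 0) :
    ∃ b ∈ Semifree.deg k cDeg (n - 1), D k p q b = c := by
  obtain ⟨a, ha, m, h, rfl⟩ := cocycle_eq hp hpq n hc hDc
  have h0 : toCyc k p a = 0 := by
    rw [map_add, piAlgHom_D, add_zero, map_mul, map_pow] at hπ
    have h1 := congrArg (ePoly k p) hπ
    rw [map_mul, map_pow, map_zero, ePoly_piAlgHom_deg_zero ha] at h1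
    have h2 := congrArg (ePoly k p) (piAlgHom_polyGen (k := k) p q)
    rw [map_mul, map_mul, map_smul, ePoly_gamma] at h2
    -- Multiplying the relation by the m-th power of the image of x^q replaces the image of
    -- `polyGen` by pT; the coefficient of T^m then isolates p^m times the class of a.
    have h3 : Polynomial.C (toCyc k p a) * ((p : k) • Polynomial.X) ^ m = 0 := by
      rw [← h2, mul_pow, mul_left_comm, h1, mul_zero]
    rw [smul_pow, mul_smul_comm] at h3
    have h4 := congrArg (Polynomial.coeff · m) h3
    simp only [Polynomial.coeff_smul, Polynomial.coeff_C_mul_X_pow, if_true,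
      Polynomial.coeff_zero] at h4
    have h5 : ∀ (m : ℕ) (v : CycAlg k p), (p : k) ^ m • v = 0 → v = 0 := by
      intro m v hv
      ext i
      have h6 : (p : k) ^ m * v.coeff i = 0 := by
        have := congrArg (fun v => AddMonoidAlgebra.coeff v i) hv
        simpa using this
      clear hv
      induction m with
      | zero => simpa using h6
      | succ m ih => exact ih (hreg _ (by rw [← h6]; ring))
    exact h5 m _ h4
  obtain ⟨b, rfl⟩ := exact_of_toCyc_eq_zero q ha h0
  refine ⟨component (n - 1) (b * polyGen k p q ^ m + h), component_mem _ _, ?_⟩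
  rw [← component_D, sub_add_cancel, map_add, D_mul_polyGen_pow, component_of_mem hc]

theorem pi_quasiFaithful {p q : ℕ} (hp : 1 < p) (hpq : Nat.Coprime p q)
    (hreg : ∀ r : k, (p : k) * r = 0 → r = 0) : (π k p q).QuasiFaithful := by
  intro A B n
  refine (π k p q).cohomologyMap_injective ?_
  rintro f ⟨hf, hfn⟩ ⟨e, -, he⟩
  obtain ⟨b, hb, hbf⟩ := exact_of_piAlgHom_eq_zero hp hpq hreg hfn hf he.symm
  exact ⟨b, hb, hbf⟩

/-- Cocycles are closed under products, so lifting the two generators suffices: α to x, and γ to r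
x^q times `polyGen`. -/
theorem exists_cocycle_lift {p q : ℕ} {r : k} (hr : r * p = 1) {n : ℤ} {g : EAlg k p}
    (hg : g ∈ wordDeg k (eGen k p) eDeg n) :
    ∃ f ∈ Semifree.deg k cDeg n, D k p q f = 0 ∧ piAlgHom k p f = g := by
  induction hg using Submodule.span_induction with
  | mem g h =>
    obtain ⟨l, rfl, rfl⟩ := h
    induction l with
    | nil => exact ⟨1, SetLike.one_mem_graded (Semifree.deg k cDeg), Semifree.d_one _ _, map_one _⟩
    | cons i l ih =>
      obtain ⟨f, hf, hDf, hfl⟩ := ih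
      simp only [List.map_cons, List.prod_cons, List.sum_cons]
      cases i with
      | α =>
        refine ⟨X k ^ 1 * f, mul_mem_deg (x_pow_mem k 1) hf rfl, ?_, ?_⟩
        · rw [D_X_pow_mul, hDf, mul_zero]
        · rw [map_mul, pow_one, piAlgHom_X, hfl]
      | γ =>
        refine ⟨(r • (X k ^ q * polyGen k p q)) * f, mul_mem_deg (Submodule.smul_mem _ _
          (mul_mem_deg (x_pow_mem k q) (polyGen_mem k p q) (zero_add _))) hf rfl, ?_, ?_⟩
        · rw [D_mul, hDf, mul_zero, map_smul, D_X_pow_mul, D_polyGen, mul_zero, smul_zero,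
            zero_mul, zero_add]
        · rw [map_mul, map_smul, piAlgHom_polyGen, smul_smul, hr, one_smul, hfl]
  | zero => exact ⟨0, zero_mem _, map_zero _, map_zero _⟩
  | add g g' _ _ h h' =>
    obtain ⟨f, hf, hDf, rfl⟩ := h
    obtain ⟨f', hf', hDf', rfl⟩ := h'
    exact ⟨f + f', add_mem hf hf', by rw [map_add, hDf, hDf', add_zero], map_add _ _ _⟩
  | smul c g _ h =>
    obtain ⟨f, hf, hDf, rfl⟩ := h
    exact ⟨c • f, Submodule.smul_mem _ _ hf, by rw [map_smul, hDf, smul_zero], map_smul _ _ _⟩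

theorem pi_isQuasiEquivalence {p q : ℕ} (hp : 1 < p) (hpq : Nat.Coprime p q) {r : k}
    (hr : r * p = 1) : (π k p q).IsQuasiEquivalence := by
  refine ⟨fun A B n => ⟨pi_quasiFaithful hp hpq (fun s hs => ?_) A B n,
    (π k p q).cohomologyMap_surjective ?_⟩, fun Y =>
      ⟨PUnit.unit, (1 : EAlg k p), ?_, (1 : EAlg k p), ?_, ?_, ?_⟩⟩
  · rw [← one_mul s, ← hr, mul_assoc, hs, mul_zero]
  · rintro g ⟨-, hg⟩
    obtain ⟨f, hf, hDf, hfg⟩ := exists_cocycle_lift (q := q) hr hg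
    exact ⟨f, ⟨hDf, hf⟩, hfg⟩
  · exact ⟨(eDGA k p).d_one, (eDGA k p).one_mem⟩
  · exact ⟨(eDGA k p).d_one, (eDGA k p).one_mem⟩
  · have : (1 : EAlg k p) * 1 - 1 = 0 := by rw [one_mul, sub_self]
    exact this ▸ zero_mem _
  · have : (1 : EAlg k p) * 1 - 1 = 0 := by rw [one_mul, sub_self]
    exact this ▸ zero_mem _

end LensDGA

theorem DGCat.quasiEquivalent_of_common_target {k : Type u} [CommRing k] {C C' E : DGCat k}
    (F : DGFunctor C E) (F' : DGFunctor C' E) (hF : F.IsQuasiEquivalence)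
    (hF' : F'.IsQuasiEquivalence) : DGCat.QuasiEquivalent C C' := by
  have h : IsIso ((quasiEquivalences k).Q.map (show C ⟶ E from F)) :=
    (quasiEquivalences k).Q_inverts _ hF
  have h' : IsIso ((quasiEquivalences k).Q.map (show C' ⟶ E from F')) :=
    (quasiEquivalences k).Q_inverts _ hF'
  exact ⟨@asIso _ _ _ _ _ h ≪≫ (@asIso _ _ _ _ _ h').symm⟩

theorem corollary4p11 (p : ℕ) :
    (∀ q : ℕ, 1 ≤ q → q < p → Nat.Coprime p q → (LensDGA.π ℤ p q).QuasiFaithful) ∧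
    (∀ (k : Type u) [Field k], ¬ ringChar k ∣ p →
      (∀ q : ℕ, 1 ≤ q → q < p → Nat.Coprime p q → (LensDGA.π k p q).IsQuasiEquivalence) ∧
      (∀ q₁ q₂ : ℕ, 1 ≤ q₁ → q₁ < p → Nat.Coprime p q₁ → 1 ≤ q₂ → q₂ < p → Nat.Coprime p q₂ →
        DGCat.QuasiEquivalent (LensDGA.C k p q₁) (LensDGA.C k p q₂))) := by
  refine ⟨fun q h1 h2 h3 => LensDGA.pi_quasiFaithful (by omega) h3 fun r hr =>
    (mul_eq_zero.1 hr).resolve_left (by exact_mod_cast (by omega : p ≠ 0)), fun k _ hk => ?_⟩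
  have hpk : (p : k)⁻¹ * p = 1 := inv_mul_cancel₀ fun h => hk ((ringChar.spec k p).1 h)
  have key : ∀ q : ℕ, 1 ≤ q → q < p → Nat.Coprime p q → (LensDGA.π k p q).IsQuasiEquivalence :=
    fun q h1 h2 h3 => LensDGA.pi_isQuasiEquivalence (by omega) h3 hpk
  exact ⟨key, fun q₁ q₂ h1 h2 h3 h4 h5 h6 =>
    DGCat.quasiEquivalent_of_common_target _ _ (key q₁ h1 h2 h3) (key q₂ h4 h5 h6)⟩
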